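/- Fix a first-order signature with a set $\mathcal P$ of predicate symbols (equality not included). For a first-order formula $F$ and a finite tuple (set) $\mathbf p$ of predicate symbols, let $\mathrm{SM}_{\mathbf p}[F] := F \land \neg\exists \mathbf U\,(\mathbf U<\mathbf p \land F^*)$, where $\mathbf U$ are distinct predicate variables matching $\mathbf p$, $\mathbf U<\mathbf p$ means $(\mathbf U\le\mathbf p)\land\neg(\mathbf p\le\mathbf U)$ (componentwise inclusion), and $F^*$ is obtained recursively: atoms $p_i(\mathbf t)$ with $p_i\in\mathbf p$ become $U_i(\mathbf t)$, other atomic formulas and $\bot$ are unchanged, $*$ commutes with $\land,\lor,\forall,\exists$, and $(G\to H)^* := (G^*\to H^*)\land(G\to H)$; $\neg G$ stands for $G\to\bot$. A def-module is a pair $(\mathbf p:F)$, with $\Phi(\mathbf p:F):=\mathrm{SM}_{\mathbf p}[F]$. A modular program is a pair $\Pi=\langle\mathcal S,\mathcal M\rangle$, where $\mathcal S\subseteq\mathcal P$ is the set of public symbols and $\mathcal M$ is a finite set of def-modules and modular programs; $\Phi(\Pi):=\exists\mathbf h_0\bigwedge_{M\in\mathcal M}\Phi(M)$, where $\mathbf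 h_0$ consists of the predicate symbols that are free in some $\Phi(M)$, $M\in\mathcal M$, and not in $\mathcal S$. An interpretation is a model of $\Pi$ if it satisfies $\Phi(\Pi)$. Let $\mathit{defmods}(\Pi)$ be the set of def-modules of $\Pi$ at all levels, $\mathit{int}(\Pi)$ the union of their tuples $\mathbf p$, and $\mathcal F(\Pi)$ the conjunction of their formulas $F$. $\Pi$ is coherent if (a) it is simple: every def-module formula is a conjunction of universally closed rules whose bodies are conjunctions of expressions $a$, $\neg a$, $\neg\neg a$ and whose heads are disjunctions of atoms ($a$ atomic), and all head predicate symbols of a def-module belong to its tuple $\mathbf p$; (b) it is in $\alpha$-normal form: for each predicate symbol, either all its occurrences in $\Phi(\Pi)$ are free, or they are all bound by one and the same quantifier occurrence; (c) distinct def-modules have disjoint tuples $\mathbf p$; (d) every strongly connected component of the dependency graph (nodes $\mathit{int}(\Pi)$; an edge from $p$ to $q$ if some rule has $p$ in its head and $q$ in its positive body, that is, in a conjunct $a$ of the body) is contained in the tuple $\mathbf p$ of a single def-module. A Herbrand interpretation is identified with a set of ground atoms, and $\mathcal J|_{\mathcal S}$ is the set of atoms of $\mathcal J$ whose predicate symbol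 is in $\mathcal S$. An answer set of $\Pi=\langle\mathcal S,\mathcal M\rangle$ is a Herbrand model of $\Pi$ all of whose atoms have predicate symbols in $\mathcal S$. An answer set of $F$ for $\mathbf p$ is a Herbrand model of $\mathrm{SM}_{\mathbf p}[F]$; an answer set of $F$ is an answer set of $F$ for the tuple $\mathit{pred}(F)$ of all its predicate symbols. **Theorem.** Let $\Pi=\langle\mathcal S,\mathcal M\rangle$ be a coherent modular program such that no public symbol $q\in\mathcal S$ has a bound occurrence in $\Phi(\Pi)$ (that is, none is hidden inside a subprogram). Let $\mathbf p=\mathit{int}(\Pi)$, and let $\mathbf h$ consist of all predicate symbols that occur, free or bound, in $\Phi(\Pi)$ and are not in $\mathcal S$. (i) An interpretation $\mathcal I$ is a model of $\Pi$ if and only if $\mathcal I$ is a model of $\exists\mathbf h\,\mathrm{SM}_{\mathbf p}[\mathcal F(\Pi)]$. (ii) Suppose that the signature has a ground term. A Herbrand interpretation $\mathcal I$ is an answer set of $\Pi$ if and only if $\mathcal I=\mathcal J|_{\mathcal S}$ for some answer set $\mathcal J$ of $\mathcal F(\Pi)$ for $\mathbf p$. In particular, if $\mathit{int}(\Pi)=\mathit{pred}(\mathcal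 F(\Pi))$ (no extensional predicates), then $\mathcal I$ is an answer set of $\Pi$ if and only if $\mathcal I=\mathcal J|_{\mathcal S}$ for some answer set $\mathcal J$ of $\mathcal F(\Pi)$. -/

import Mathlib

open scoped Classical

universe u v w

noncomputable section

namespace ASP

/-- A predicate symbol of the signature `L` (a symbol together with its arity). -/
abbrev Pred (L : FirstOrder.Language.{u, v}) : Type v := Σ n : ℕ, L.Relations n

/-! ### First-order formulas

Negation and truth are the usual abbreviations `F → ⊥` and `⊥ → ⊥`. The connectives `∧`, `∨`, `∃`
are primitive because the stable model operator is not invariant under classical equivalence. -/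

inductive FOFormula (L : FirstOrder.Language.{u, v}) : Type (max u v)
  | falsum : FOFormula L
  | equal (s t : L.Term ℕ) : FOFormula L
  | atom (q : Pred L) (ts : Fin q.1 → L.Term ℕ) : FOFormula L
  | and (F G : FOFormula L) : FOFormula L
  | or (F G : FOFormula L) : FOFormula L
  | imp (F G : FOFormula L) : FOFormula L
  | all (x : ℕ) (F : FOFormula L) : FOFormula L
  | ex (x : ℕ) (F : FOFormula L) : FOFormula L

namespace FOFormula

variable {L : FirstOrder.Language.{u, v}}

def top : FOFormula L := imp falsum falsum

def neg (F : FOFormula L) : FOFormula L := imp F falsum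

/-- Finite conjunction; the empty one is `⊤`. -/
def conj : List (FOFormula L) → FOFormula L
  | [] => top
  | [F] => F
  | F :: G :: l => and F (conj (G :: l))

/-- Finite disjunction; the empty one is `⊥`. -/
def disj : List (FOFormula L) → FOFormula L
  | [] => falsum
  | [F] => F
  | F :: G :: l => or F (disj (G :: l))

/-- `∀ x₁ … xₖ F`. -/
def alls (xs : List ℕ) (F : FOFormula L) : FOFormula L := xs.foldr all F

/-- `pred(F)`: the predicate symbols (other than equality) that occur in `F`. -/
def pred : FOFormula L → Finset (Pred L)
  | falsum => ∅
  | equal _ _ => ∅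
  | atom q _ => {q}
  | and F G => pred F ∪ pred G
  | or F G => pred F ∪ pred G
  | imp F G => pred F ∪ pred G
  | all _ F => pred F
  | ex _ F => pred F

end FOFormula

/-! ### Second-order formulas -/

/-- Names that may stand in predicate position: the predicate symbols of the signature, and a
supply of further predicate variables, one variable `U_q` of the same arity for each symbol `q`. -/
inductive PName (L : FirstOrder.Language.{u, v}) : Type v
  | sym (q : Pred L) : PName L
  | var (q : Pred L) : PName L

def PName.arity {L : FirstOrder.Language.{u, v}} : PName L → ℕ
  | .sym q => q.1
  | .var q => q.1

/-- Second-order formulas. `exPred H φ` is `∃ H φ` for a finite set (tuple) `H` of predicate names;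
a predicate symbol listed in `H` is used as a bound variable. -/
inductive SOFormula (L : FirstOrder.Language.{u, v}) : Type (max u v)
  | falsum : SOFormula L
  | equal (s t : L.Term ℕ) : SOFormula L
  | atom (n : PName L) (ts : Fin n.arity → L.Term ℕ) : SOFormula L
  | and (φ ψ : SOFormula L) : SOFormula L
  | or (φ ψ : SOFormula L) : SOFormula L
  | imp (φ ψ : SOFormula L) : SOFormula L
  | all (x : ℕ) (φ : SOFormula L) : SOFormula L
  | ex (x : ℕ) (φ : SOFormula L) : SOFormula L
  | exPred (H : Finset (PName L)) (φ : SOFormula L) : SOFormula L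

/-- A value for every predicate name, over the domain `U`. -/
abbrev PVal (L : FirstOrder.Language.{u, v}) (U : Type w) : Type (max v w) :=
  ∀ n : PName L, (Fin n.arity → U) → Prop

namespace SOFormula

variable {L : FirstOrder.Language.{u, v}}

def top : SOFormula L := imp falsum falsum

def neg (φ : SOFormula L) : SOFormula L := imp φ falsum

def conj : List (SOFormula L) → SOFormula L
  | [] => top
  | [φ] => φ
  | φ :: ψ :: l => and φ (conj (ψ :: l))

def alls (xs : List ℕ) (φ : SOFormula L) : SOFormula L := xs.foldr all φ

/-- Satisfaction. The structure `I` interprets the function symbols, `ρ` the predicate names and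
`e` the first-order variables. -/
def Sat {U : Type w} (I : L.Structure U) : PVal L U → (ℕ → U) → SOFormula L → Prop
  | _, _, falsum => False
  | _, e, equal s t => s.realize e = t.realize e
  | ρ, e, atom n ts => ρ n (fun i => (ts i).realize e)
  | ρ, e, and φ ψ => Sat I ρ e φ ∧ Sat I ρ e ψ
  | ρ, e, or φ ψ => Sat I ρ e φ ∨ Sat I ρ e ψ
  | ρ, e, imp φ ψ => Sat I ρ e φ → Sat I ρ e ψ
  | ρ, e, all x φ => ∀ a : U, Sat I ρ (Function.update e x a) φ
  | ρ, e, ex x φ => ∃ a : U, Sat I ρ (Function.update e x a) φ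
  | ρ, e, exPred H φ => ∃ ρ' : PVal L U, (∀ n, n ∉ H → ρ' n = ρ n) ∧ Sat I ρ' e φ

/-- The interpretation `I` (a domain, functions and relations) is a model of `φ`. Free individual
variables and free predicate variables, if any, are read universally. -/
def IsModel {U : Type w} (I : L.Structure U) (φ : SOFormula L) : Prop :=
  ∀ ρ : PVal L U, (∀ (q : Pred L) (a : Fin q.1 → U), ρ (.sym q) a ↔ I.RelMap q.2 a) →
    ∀ e : ℕ → U, Sat I ρ e φ

/-- The predicate symbols with a free occurrence in a formula. -/
def free : SOFormula L → Finset (Pred L)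
  | falsum => ∅
  | equal _ _ => ∅
  | atom (.sym q) _ => {q}
  | atom (.var _) _ => ∅
  | and φ ψ => free φ ∪ free ψ
  | or φ ψ => free φ ∪ free ψ
  | imp φ ψ => free φ ∪ free ψ
  | all _ φ => free φ
  | ex _ φ => free φ
  | exPred H φ => (free φ).filter (fun q => PName.sym q ∉ H)

/-- The predicate symbols with an occurrence, free or bound, in a formula. -/
def occ : SOFormula L → Finset (Pred L)
  | falsum => ∅
  | equal _ _ => ∅
  | atom (.sym q) _ => {q}
  | atom (.var _) _ => ∅
  | and φ ψ => occ φ ∪ occ ψ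
  | or φ ψ => occ φ ∪ occ ψ
  | imp φ ψ => occ φ ∪ occ ψ
  | all _ φ => occ φ
  | ex _ φ => occ φ
  | exPred _ φ => occ φ

/-- All occurrences of the symbol `q` in the formula are free. -/
def AllFree (q : Pred L) : SOFormula L → Prop
  | falsum => True
  | equal _ _ => True
  | atom _ _ => True
  | and φ ψ => AllFree q φ ∧ AllFree q ψ
  | or φ ψ => AllFree q φ ∧ AllFree q ψ
  | imp φ ψ => AllFree q φ ∧ AllFree q ψ
  | all _ φ => AllFree q φ
  | ex _ φ => AllFree q φ
  | exPred H φ => AllFree q φ ∧ (PName.sym q ∈ H → q ∉ occ φ)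

/-- There is one occurrence of an existential predicate quantifier in the formula such that all
occurrences of `q` in the formula are bound by it. -/
def OneBinder (q : Pred L) : SOFormula L → Prop
  | falsum => False
  | equal _ _ => False
  | atom _ _ => False
  | and φ ψ => (OneBinder q φ ∧ q ∉ occ ψ) ∨ (q ∉ occ φ ∧ OneBinder q ψ)
  | or φ ψ => (OneBinder q φ ∧ q ∉ occ ψ) ∨ (q ∉ occ φ ∧ OneBinder q ψ)
  | imp φ ψ => (OneBinder q φ ∧ q ∉ occ ψ) ∨ (q ∉ occ φ ∧ OneBinder q ψ)
  | all _ φ => OneBinder q φ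
  | ex _ φ => OneBinder q φ
  | exPred H φ => (PName.sym q ∈ H ∧ AllFree q φ) ∨ OneBinder q φ

end SOFormula

/-! ### The stable model operator -/

namespace FOFormula

variable {L : FirstOrder.Language.{u, v}}

/-- A first-order formula as a second-order one. -/
def toSO : FOFormula L → SOFormula L
  | falsum => .falsum
  | equal s t => .equal s t
  | atom q ts => .atom (.sym q) ts
  | and F G => .and F.toSO G.toSO
  | or F G => .or F.toSO G.toSO
  | imp F G => .imp F.toSO G.toSO
  | all x F => .all x F.toSO
  | ex x F => .ex x F.toSO

/-- `F*`, with the variable `U_q` in place of each `q ∈ p`. -/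
def star (p : Finset (Pred L)) : FOFormula L → SOFormula L
  | falsum => .falsum
  | equal s t => .equal s t
  | atom q ts => if q ∈ p then .atom (.var q) ts else .atom (.sym q) ts
  | and F G => .and (star p F) (star p G)
  | or F G => .or (star p F) (star p G)
  | imp F G => .and (.imp (star p F) (star p G)) (.imp F.toSO G.toSO)
  | all x F => .all x (star p F)
  | ex x F => .ex x (star p F)

end FOFormula

section SM

variable {L : FirstOrder.Language.{u, v}}

/-- `U_q ≤ q`, that is `∀ x (U_q(x) → q(x))`. -/
def varLe (q : Pred L) : SOFormula L :=
  .alls (List.range q.1)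
    (.imp (.atom (.var q) (fun i : Fin q.1 => FirstOrder.Language.Term.var (i : ℕ)))
      (.atom (.sym q) (fun i : Fin q.1 => FirstOrder.Language.Term.var (i : ℕ))))

/-- `q ≤ U_q`, that is `∀ x (q(x) → U_q(x))`. -/
def leVar (q : Pred L) : SOFormula L :=
  .alls (List.range q.1)
    (.imp (.atom (.sym q) (fun i : Fin q.1 => FirstOrder.Language.Term.var (i : ℕ)))
      (.atom (.var q) (fun i : Fin q.1 => FirstOrder.Language.Term.var (i : ℕ))))

/-- `U < p`, that is `(U ≤ p) ∧ ¬ (p ≤ U)`. -/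
def varsLt (p : Finset (Pred L)) : SOFormula L :=
  .and (.conj (p.toList.map varLe)) (.neg (.conj (p.toList.map leVar)))

/-- The tuple `U` of the predicate variables `U_q`, `q ∈ p`. -/
def varsOf (p : Finset (Pred L)) : Finset (PName L) := p.image PName.var

/-- `SM_p[F] = F ∧ ¬ ∃ U ((U < p) ∧ F*)`. -/
def SM (p : Finset (Pred L)) (F : FOFormula L) : SOFormula L :=
  .and F.toSO (.neg (.exPred (varsOf p) (.and (varsLt p) (F.star p))))

/-- `∃ h φ` for a finite set `h` of predicate symbols. -/
def exSyms (h : Finset (Pred L)) (φ : SOFormula L) : SOFormula L :=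
  .exPred (h.image PName.sym) φ

end SM

/-! ### Modular programs -/

/-- A module is a def-module `(p : F)` or a modular program `⟨S, M⟩` with public symbols `S` and a
finite collection `M` of modules. -/
inductive Module (L : FirstOrder.Language.{u, v}) : Type (max u v)
  | defm (p : Finset (Pred L)) (F : FOFormula L) : Module L
  | prog (S : Set (Pred L)) (Ms : List (Module L)) : Module L

namespace Module

variable {L : FirstOrder.Language.{u, v}}

mutual

/-- The formula `Φ(M)`: `SM_p[F]` for a def-module `(p : F)`, and `∃ h ⋀ Φ(Mᵢ)` for a modular
program, where `h` consists of the free predicate symbols of the `Φ(Mᵢ)` that are not public. -/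
def Phi : Module L → SOFormula L
  | defm p F => SM p F
  | prog S Ms =>
      exSyms ((SOFormula.conj (PhiList Ms)).free.filter (fun q => q ∉ S))
        (SOFormula.conj (PhiList Ms))

def PhiList : List (Module L) → List (SOFormula L)
  | [] => []
  | M :: Ms => Phi M :: PhiList Ms

end

mutual

/-- The def-modules `(p, F)` at any level of the hierarchy. -/
def defmods : Module L → List (Finset (Pred L) × FOFormula L)
  | defm p F => [(p, F)]
  | prog _ Ms => defmodsList Ms

def defmodsList : List (Module L) → List (Finset (Pred L) × FOFormula L)
  | [] => []
  | M :: Ms => defmods M ++ defmodsList Ms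

end

/-- `int(P)`: all intensional predicate symbols. -/
def int (P : Module L) : Finset (Pred L) := (P.defmods.toFinset).biUnion Prod.fst

/-- The conjunction of all def-module formulas of `P`. -/
def flatConj (P : Module L) : FOFormula L := .conj (P.defmods.map Prod.snd)

/-- The interpretation `I` is a model of the program `P`. -/
def IsModelOf {U : Type w} (I : L.Structure U) (P : Module L) : Prop := P.Phi.IsModel I

/-- `α`-normal form: for every predicate symbol, all its occurrences in `Φ(P)` are free, or they
are all bound by one and the same quantifier occurrence. -/
def IsAlphaNF (P : Module L) : Prop := ∀ q : Pred L, P.Phi.AllFree q ∨ P.Phi.OneBinder q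

end Module

/-! ### Rules and coherence -/

section Rules

variable (L : FirstOrder.Language.{u, v})

/-- The atoms from which rules are built. -/
inductive RuleAtom : Type (max u v)
  | equal (s t : L.Term ℕ) : RuleAtom
  | atom (q : Pred L) (ts : Fin q.1 → L.Term ℕ) : RuleAtom

variable {L}

def RuleAtom.toFormula : RuleAtom L → FOFormula L
  | .equal s t => .equal s t
  | .atom q ts => .atom q ts

def RuleAtom.HasVar (x : ℕ) : RuleAtom L → Prop
  | .equal s t => x ∈ s.varFinset ∨ x ∈ t.varFinset
  | .atom _ ts => ∃ i, x ∈ (ts i).varFinset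

/-- `q` is the predicate symbol of an atom of the list. -/
def PredIn (q : Pred L) (l : List (RuleAtom L)) : Prop :=
  ∃ ts : Fin q.1 → L.Term ℕ, RuleAtom.atom q ts ∈ l

variable (L)

/-- A rule: the universal closure of
`pos ∧ … ∧ ¬ neg ∧ … ∧ ¬¬ dneg ∧ … → head ∨ …`. The list `vars` holds its variables in the order
in which the universal closure quantifies them. -/
structure Rule where
  head : List (RuleAtom L)
  pos : List (RuleAtom L)
  neg : List (RuleAtom L)
  dneg : List (RuleAtom L)
  vars : List ℕ
  nodup_vars : vars.Nodup
  mem_vars : ∀ x, x ∈ vars ↔ ∃ a ∈ head ++ pos ++ neg ++ dneg, a.HasVar x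

variable {L}

/-- The conjuncts of the body, in order. -/
def Rule.body (r : Rule L) : List (FOFormula L) :=
  r.pos.map RuleAtom.toFormula ++ r.neg.map (fun a => a.toFormula.neg) ++
    r.dneg.map (fun a => a.toFormula.neg.neg)

/-- The rule without its quantifiers; a rule with empty body is just its head. -/
def Rule.matrix (r : Rule L) : FOFormula L :=
  if r.body = [] then .disj (r.head.map RuleAtom.toFormula)
  else .imp (.conj r.body) (.disj (r.head.map RuleAtom.toFormula))

def Rule.toFormula (r : Rule L) : FOFormula L := .alls r.vars r.matrix

/-- Conjunctions of rules (of any number of rules, bracketed in any way). -/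
inductive IsRuleConj : FOFormula L → Prop
  | top : IsRuleConj .top
  | rule (r : Rule L) : IsRuleConj r.toFormula
  | and {F G : FOFormula L} : IsRuleConj F → IsRuleConj G → IsRuleConj (.and F G)

/-- The rule `r` is one of the conjuncts of a formula. -/
inductive Rule.OccursIn (r : Rule L) : FOFormula L → Prop
  | self : Rule.OccursIn r r.toFormula
  | left {F G : FOFormula L} : Rule.OccursIn r F → Rule.OccursIn r (.and F G)
  | right {F G : FOFormula L} : Rule.OccursIn r G → Rule.OccursIn r (.and F G)

end Rules

namespace Module

variable {L : FirstOrder.Language.{u, v}}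

/-- Every def-module formula is a conjunction of rules whose head predicate symbols are
intensional in that def-module. -/
def IsSimple (P : Module L) : Prop :=
  ∀ M ∈ P.defmods, IsRuleConj M.2 ∧
    ∀ r : Rule L, r.OccursIn M.2 → ∀ q : Pred L, PredIn q r.head → q ∈ M.1

/-- The edges of the dependency graph, whose set of nodes is `int(P)`. -/
def DepEdge (P : Module L) (p q : Pred L) : Prop :=
  p ∈ P.int ∧ q ∈ P.int ∧
    ∃ M ∈ P.defmods, ∃ r : Rule L, r.OccursIn M.2 ∧ PredIn p r.head ∧ PredIn q r.pos

/-- `C` is a strongly connected component of the dependency graph. -/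
def IsSCC (P : Module L) (C : Set (Pred L)) : Prop :=
  ∃ p ∈ P.int, C = {q | q ∈ P.int ∧ Relation.ReflTransGen P.DepEdge p q ∧
    Relation.ReflTransGen P.DepEdge q p}

structure IsCoherent (P : Module L) : Prop where
  simple : P.IsSimple
  alphaNF : P.IsAlphaNF
  disjoint : ∀ M ∈ P.defmods, ∀ M' ∈ P.defmods, M ≠ M' → Disjoint M.1 M'.1
  scc : ∀ C : Set (Pred L), P.IsSCC C → ∃ M ∈ P.defmods, ∀ q ∈ C, q ∈ M.1

end Module

/-! ### Herbrand interpretations and answer sets -/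

section Herbrand

variable (L : FirstOrder.Language.{u, v})

/-- Ground terms: the Herbrand universe. -/
abbrev GroundTerm : Type u := L.Term Empty

/-- Ground atoms; a Herbrand interpretation is a set of them. -/
abbrev GroundAtom : Type (max u v) := Σ q : Pred L, (Fin q.1 → GroundTerm L)

variable {L}

/-- The Herbrand interpretation with the given set of true ground atoms, as a structure on the
ground terms. -/
@[reducible] def herbrand (A : Set (GroundAtom L)) : L.Structure (GroundTerm L) where
  funMap f ts := FirstOrder.Language.Term.func f ts
  RelMap {n} r ts := (⟨⟨n, r⟩, ts⟩ : GroundAtom L) ∈ A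

/-- The restriction of a Herbrand interpretation to the predicate symbols in `S`. -/
def restrict (A : Set (GroundAtom L)) (S : Set (Pred L)) : Set (GroundAtom L) :=
  {a | a ∈ A ∧ a.1 ∈ S}

/-- Answer sets of `F` for the intensional predicates `p`: the Herbrand models of `SM_p[F]`. -/
def IsAnswerSetFor (p : Finset (Pred L)) (F : FOFormula L) (A : Set (GroundAtom L)) : Prop :=
  (SM p F).IsModel (herbrand A)

/-- Answer sets of `F`: all the predicate symbols of `F` are intensional. -/
def IsAnswerSet (F : FOFormula L) (A : Set (GroundAtom L)) : Prop :=
  IsAnswerSetFor F.pred F A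

/-- Answer sets of `⟨S, M⟩`: its Herbrand models among the interpretations over `S`. -/
def IsProgAnswerSet (S : Set (Pred L)) (Ms : List (Module L)) (A : Set (GroundAtom L)) : Prop :=
  (∀ a ∈ A, a.1 ∈ S) ∧ (Module.prog S Ms).IsModelOf (herbrand A)

end Herbrand

end ASP

end

namespace ASP

open FirstOrder

section HereThere

variable {L : FirstOrder.Language.{u, v}} {U : Type w}

/-- A value for every predicate symbol, over the domain `U`. -/
abbrev SymVal (L : FirstOrder.Language.{u, v}) (U : Type w) : Type (max v w) :=
  ∀ q : Pred L, (Fin q.1 → U) → Prop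

/-- Classical satisfaction of a first-order formula. -/
def Holds (I : L.Structure U) (σ : SymVal L U) : (ℕ → U) → FOFormula L → Prop
  | _, .falsum => False
  | e, .equal s t => s.realize e = t.realize e
  | e, .atom q ts => σ q (fun i => (ts i).realize e)
  | e, .and F G => Holds I σ e F ∧ Holds I σ e G
  | e, .or F G => Holds I σ e F ∨ Holds I σ e G
  | e, .imp F G => Holds I σ e F → Holds I σ e G
  | e, .all x F => ∀ a : U, Holds I σ (Function.update e x a) F
  | e, .ex x F => ∃ a : U, Holds I σ (Function.update e x a) F

/-- Satisfaction in the logic of here-and-there, with `τ` the predicates "here" and `σ` those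
"there". -/
def Here (I : L.Structure U) (τ σ : SymVal L U) : (ℕ → U) → FOFormula L → Prop
  | _, .falsum => False
  | e, .equal s t => s.realize e = t.realize e
  | e, .atom q ts => τ q (fun i => (ts i).realize e)
  | e, .and F G => Here I τ σ e F ∧ Here I τ σ e G
  | e, .or F G => Here I τ σ e F ∨ Here I τ σ e G
  | e, .imp F G => (Here I τ σ e F → Here I τ σ e G) ∧ (Holds I σ e F → Holds I σ e G)
  | e, .all x F => ∀ a : U, Here I τ σ (Function.update e x a) F
  | e, .ex x F => ∃ a : U, Here I τ σ (Function.update e x a) F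

/-- The predicates `σ` form a stable model of `F` with respect to the intensional symbols `p`. -/
def Stable (I : L.Structure U) (e : ℕ → U) (p : Finset (Pred L)) (F : FOFormula L)
    (σ : SymVal L U) : Prop :=
  Holds I σ e F ∧ ∀ τ : SymVal L U, (∀ q ∉ p, τ q = σ q) → (∀ q a, τ q a → σ q a) →
    Here I τ σ e F → τ = σ

/-- The values of the predicate symbols. -/
def PVal.symVal (ρ : PVal L U) : SymVal L U := fun q => ρ (.sym q)

/-- The values of the predicate variables. -/
def PVal.varVal (ρ : PVal L U) : SymVal L U := fun q => ρ (.var q)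

/-- The value of all predicate names with given values of the symbols and of the variables. -/
def PVal.ofVals (σ τ : SymVal L U) : PVal L U
  | .sym q => σ q
  | .var q => τ q

@[simp] theorem PVal.symVal_ofVals (σ τ : SymVal L U) : (PVal.ofVals σ τ).symVal = σ := rfl

@[simp] theorem PVal.varVal_ofVals (σ τ : SymVal L U) : (PVal.ofVals σ τ).varVal = τ := rfl

theorem sat_toSO (I : L.Structure U) (ρ : PVal L U) (e : ℕ → U) (F : FOFormula L) :
    SOFormula.Sat I ρ e F.toSO ↔ Holds I ρ.symVal e F := by
  induction F generalizing e with
  | atom q ts => rfl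
  | _ => simp_all [FOFormula.toSO, SOFormula.Sat, Holds]

theorem sat_star (I : L.Structure U) (ρ : PVal L U) (e : ℕ → U) (p : Finset (Pred L))
    (F : FOFormula L) :
    SOFormula.Sat I ρ e (F.star p) ↔
      Here I (fun q => if q ∈ p then ρ.varVal q else ρ.symVal q) ρ.symVal e F := by
  induction F generalizing e with
  | atom q ts =>
    by_cases hq : q ∈ p <;> simp only [FOFormula.star, Here, hq, if_true, if_false] <;> rfl
  | _ => simp_all [FOFormula.star, SOFormula.Sat, Here, sat_toSO]

theorem forall_update_forall_iff {x : ℕ} {xs : List ℕ} (P : (ℕ → U) → Prop) (e : ℕ → U) :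
    (∀ a : U, ∀ e' : ℕ → U, (∀ y ∉ xs, e' y = Function.update e x a y) → P e') ↔
      ∀ e' : ℕ → U, (∀ y ∉ x :: xs, e' y = e y) → P e' := by
  constructor
  · intro H e' he
    refine H (e' x) e' fun y hy => ?_
    by_cases hyx : y = x
    · subst hyx; simp
    · rw [Function.update_of_ne hyx]
      exact he y (by simp [hyx, hy])
  · intro H a e' he
    refine H e' fun y hy => ?_
    simp only [List.mem_cons, not_or] at hy
    rw [he y hy.2, Function.update_of_ne hy.1]

theorem sat_alls (I : L.Structure U) (ρ : PVal L U) (e : ℕ → U) (xs : List ℕ)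
    (φ : SOFormula L) : SOFormula.Sat I ρ e (.alls xs φ) ↔
      ∀ e' : ℕ → U, (∀ y ∉ xs, e' y = e y) → SOFormula.Sat I ρ e' φ := by
  induction xs generalizing e with
  | nil =>
    refine ⟨fun H e' he => ?_, fun H => H e fun _ _ => rfl⟩
    rwa [show e' = e from funext fun y => he y (by simp)]
  | cons x xs ih =>
    rw [← forall_update_forall_iff]
    exact forall_congr' fun a => ih _

theorem holds_alls (I : L.Structure U) (σ : SymVal L U) (e : ℕ → U) (xs : List ℕ)
    (F : FOFormula L) : Holds I σ e (.alls xs F) ↔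
      ∀ e' : ℕ → U, (∀ y ∉ xs, e' y = e y) → Holds I σ e' F := by
  induction xs generalizing e with
  | nil =>
    refine ⟨fun H e' he => ?_, fun H => H e fun _ _ => rfl⟩
    rwa [show e' = e from funext fun y => he y (by simp)]
  | cons x xs ih =>
    rw [← forall_update_forall_iff]
    exact forall_congr' fun a => ih _

theorem here_alls (I : L.Structure U) (τ σ : SymVal L U) (e : ℕ → U) (xs : List ℕ)
    (F : FOFormula L) : Here I τ σ e (.alls xs F) ↔
      ∀ e' : ℕ → U, (∀ y ∉ xs, e' y = e y) → Here I τ σ e' F := by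
  induction xs generalizing e with
  | nil =>
    refine ⟨fun H e' he => ?_, fun H => H e fun _ _ => rfl⟩
    rwa [show e' = e from funext fun y => he y (by simp)]
  | cons x xs ih =>
    rw [← forall_update_forall_iff]
    exact forall_congr' fun a => ih _

theorem sat_conj (I : L.Structure U) (ρ : PVal L U) (e : ℕ → U) (l : List (SOFormula L)) :
    SOFormula.Sat I ρ e (.conj l) ↔ ∀ φ ∈ l, SOFormula.Sat I ρ e φ := by
  induction l using SOFormula.conj.induct <;>
    simp_all [SOFormula.conj, SOFormula.top, SOFormula.Sat]

theorem holds_conj (I : L.Structure U) (σ : SymVal L U) (e : ℕ → U) (l : List (FOFormula L)) :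
    Holds I σ e (.conj l) ↔ ∀ F ∈ l, Holds I σ e F := by
  induction l using FOFormula.conj.induct <;> simp_all [FOFormula.conj, FOFormula.top, Holds]

theorem here_conj (I : L.Structure U) (τ σ : SymVal L U) (e : ℕ → U) (l : List (FOFormula L)) :
    Here I τ σ e (.conj l) ↔ ∀ F ∈ l, Here I τ σ e F := by
  induction l using FOFormula.conj.induct <;>
    simp_all [FOFormula.conj, FOFormula.top, Here, Holds]

theorem holds_disj (I : L.Structure U) (σ : SymVal L U) (e : ℕ → U) (l : List (FOFormula L)) :
    Holds I σ e (.disj l) ↔ ∃ F ∈ l, Holds I σ e F := by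
  induction l using FOFormula.disj.induct <;> simp_all [FOFormula.disj, Holds]

theorem here_disj (I : L.Structure U) (τ σ : SymVal L U) (e : ℕ → U) (l : List (FOFormula L)) :
    Here I τ σ e (.disj l) ↔ ∃ F ∈ l, Here I τ σ e F := by
  induction l using FOFormula.disj.induct <;> simp_all [FOFormula.disj, Here]

theorem forall_tuple_iff {n : ℕ} (P : (Fin n → U) → Prop) (e : ℕ → U) :
    (∀ e' : ℕ → U, (∀ y ∉ List.range n, e' y = e y) → P fun i => e' i) ↔ ∀ a, P a := by
  refine ⟨fun H a => ?_, fun H e' _ => H _⟩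
  have := H (fun y => if h : y < n then a ⟨y, h⟩ else e y) (fun y hy => by
    simp only [List.mem_range] at hy
    simp [hy])
  simpa using this

theorem sat_varLe (I : L.Structure U) (ρ : PVal L U) (e : ℕ → U) (q : Pred L) :
    SOFormula.Sat I ρ e (varLe q) ↔ ∀ a : Fin q.1 → U, ρ (.var q) a → ρ (.sym q) a := by
  rw [varLe, sat_alls]
  exact forall_tuple_iff (fun a : Fin q.1 → U => ρ (.var q) a → ρ (.sym q) a) e

theorem sat_leVar (I : L.Structure U) (ρ : PVal L U) (e : ℕ → U) (q : Pred L) :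
    SOFormula.Sat I ρ e (leVar q) ↔ ∀ a : Fin q.1 → U, ρ (.sym q) a → ρ (.var q) a := by
  rw [leVar, sat_alls]
  exact forall_tuple_iff (fun a : Fin q.1 → U => ρ (.sym q) a → ρ (.var q) a) e

theorem sat_varsLt (I : L.Structure U) (ρ : PVal L U) (e : ℕ → U) (p : Finset (Pred L)) :
    SOFormula.Sat I ρ e (varsLt p) ↔
      (∀ q ∈ p, ∀ a : Fin q.1 → U, ρ.varVal q a → ρ.symVal q a) ∧
        ¬ ∀ q ∈ p, ∀ a : Fin q.1 → U, ρ.symVal q a → ρ.varVal q a := by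
  simp only [varsLt, SOFormula.Sat, SOFormula.neg, sat_conj, List.forall_mem_map,
    Finset.mem_toList, sat_varLe, sat_leVar]
  rfl

theorem sat_exPred_varsOf (I : L.Structure U) (ρ : PVal L U) (e : ℕ → U)
    (p : Finset (Pred L)) (φ : SOFormula L) :
    SOFormula.Sat I ρ e (.exPred (varsOf p) φ) ↔ ∃ τ : SymVal L U,
      (∀ q ∉ p, τ q = ρ.varVal q) ∧ SOFormula.Sat I (.ofVals ρ.symVal τ) e φ := by
  simp only [SOFormula.Sat]
  constructor
  · rintro ⟨ρ', hρ', h⟩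
    refine ⟨ρ'.varVal, fun q hq => hρ' _ (by simpa [varsOf] using hq), ?_⟩
    convert h using 1
    funext n
    cases n with
    | sym q => exact (hρ' (.sym q) (by simp [varsOf])).symm
    | var q => rfl
  · rintro ⟨τ, hτ, h⟩
    refine ⟨_, ?_, h⟩
    rintro (q | q) hn
    · rfl
    · exact hτ q fun hq => hn (Finset.mem_image_of_mem _ hq)

theorem sat_SM (I : L.Structure U) (ρ : PVal L U) (e : ℕ → U) (p : Finset (Pred L))
    (F : FOFormula L) :
    SOFormula.Sat I ρ e (SM p F) ↔ Stable I e p F ρ.symVal := by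
  change SOFormula.Sat I ρ e F.toSO ∧ ¬ SOFormula.Sat I ρ e (.exPred (varsOf p) _) ↔ _
  rw [sat_exPred_varsOf]
  simp only [SOFormula.Sat, sat_toSO, sat_star, sat_varsLt, Stable,
    PVal.symVal_ofVals, PVal.varVal_ofVals]
  refine and_congr_right fun _ => ⟨fun H τ hτ hle hF => ?_, ?_⟩
  · by_contra hne
    apply H
    refine ⟨fun q => if q ∈ p then τ q else ρ.varVal q, fun q hq => by simp [hq],
      ⟨fun q hq a => by simpa [hq] using hle q a, fun hall => hne ?_⟩, ?_⟩
    · funext q a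
      by_cases hq : q ∈ p
      · refine propext ⟨hle q a, fun h => ?_⟩
        simpa [hq] using hall q hq a h
      · rw [hτ q hq]
    · convert hF using 1
      funext q
      by_cases hq : q ∈ p
      · simp [hq]
      · simp [hq, hτ q hq]
  · rintro H ⟨τ, _, ⟨hle, hnle⟩, hF⟩
    have := H _ (fun q hq => by simp [hq]) (fun q a h => ?_) hF
    · refine hnle fun q hq a h => ?_
      have h2 := congrFun (congrFun this q) a
      simp only [hq, if_true] at h2
      rwa [h2]
    · by_cases hq : q ∈ p
      · exact hle q hq a (by simpa [hq] using h)
      · simpa [hq] using h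

theorem holds_congr (I : L.Structure U) {σ σ' : SymVal L U} (e : ℕ → U) (F : FOFormula L)
    (h : ∀ q ∈ F.pred, σ q = σ' q) : Holds I σ e F ↔ Holds I σ' e F := by
  induction F generalizing e <;> simp_all [FOFormula.pred, Holds]

theorem here_congr (I : L.Structure U) {τ τ' σ σ' : SymVal L U} (e : ℕ → U) (F : FOFormula L)
    (hτ : ∀ q ∈ F.pred, τ q = τ' q) (h : ∀ q ∈ F.pred, σ q = σ' q) :
    Here I τ σ e F ↔ Here I τ' σ' e F := by
  induction F generalizing e with
  | imp F G ihF ihG =>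
    simp only [FOFormula.pred, Finset.mem_union, or_imp, forall_and] at hτ h
    simp only [Here, ihF e hτ.1 h.1, ihG e hτ.2 h.2, holds_congr I e F h.1,
      holds_congr I e G h.2]
  | _ => simp_all [FOFormula.pred, Here]

theorem Stable.congr {I : L.Structure U} {σ σ' : SymVal L U} {e : ℕ → U} {p : Finset (Pred L)}
    {F : FOFormula L} (hs : Stable I e p F σ) (hp : ∀ q ∈ p, σ q = σ' q)
    (hF : ∀ q ∈ F.pred, σ q = σ' q) : Stable I e p F σ' := by
  refine ⟨(holds_congr I e F hF).1 hs.1, fun τ hτ hle hH => ?_⟩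
  have key := hs.2 (fun q => if q ∈ p then τ q else σ q) (fun q hq => by simp [hq]) ?_ ?_
  · funext q
    by_cases hq : q ∈ p
    · have := congrFun key q
      simp only [hq, if_true] at this
      rw [this, hp q hq]
    · exact hτ q hq
  · intro q a h
    by_cases hq : q ∈ p
    · simp only [hq, if_true] at h
      rw [hp q hq]
      exact hle q a h
    · simpa [hq] using h
  · refine (here_congr I e F (fun q hq => ?_) hF).2 hH
    split_ifs with hqp
    · rfl
    · rw [hF q hq, hτ q hqp]

end HereThere

section RuleSemantics

variable {L : FirstOrder.Language.{u, v}} {U : Type w}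

def RuleAtom.Eval (I : L.Structure U) (σ : SymVal L U) (e : ℕ → U) : RuleAtom L → Prop
  | .equal s t => s.realize e = t.realize e
  | .atom q ts => σ q (fun i => (ts i).realize e)

theorem RuleAtom.holds_toFormula (I : L.Structure U) (σ : SymVal L U) (e : ℕ → U)
    (a : RuleAtom L) : Holds I σ e a.toFormula ↔ a.Eval I σ e := by
  cases a <;> rfl

theorem RuleAtom.here_toFormula (I : L.Structure U) (τ σ : SymVal L U) (e : ℕ → U)
    (a : RuleAtom L) : Here I τ σ e a.toFormula ↔ a.Eval I τ e := by
  cases a <;> rfl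

theorem RuleAtom.Eval.mono {I : L.Structure U} {τ σ : SymVal L U} {e : ℕ → U} {a : RuleAtom L}
    (hle : ∀ q a, τ q a → σ q a) (h : a.Eval I τ e) : a.Eval I σ e := by
  cases a
  · exact h
  · exact hle _ _ h

theorem realize_congr (I : L.Structure U) {e e' : ℕ → U} (t : L.Term ℕ)
    (h : ∀ x ∈ t.varFinset, e x = e' x) : t.realize e = t.realize e' := by
  induction t with
  | var x => exact h x (by simp [Language.Term.varFinset])
  | func f ts ih =>
    simp only [Language.Term.realize]
    congr 1
    funext i
    refine ih i fun x hx => h x ?_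
    simp only [Language.Term.varFinset, Finset.mem_biUnion, Finset.mem_univ, true_and]
    exact ⟨i, hx⟩

theorem RuleAtom.eval_congr (I : L.Structure U) (σ : SymVal L U) {e e' : ℕ → U}
    (a : RuleAtom L) (h : ∀ x, a.HasVar x → e x = e' x) : a.Eval I σ e ↔ a.Eval I σ e' := by
  cases a with
  | equal s t =>
    simp only [RuleAtom.Eval, realize_congr I s fun x hx => h x (Or.inl hx),
      realize_congr I t fun x hx => h x (Or.inr hx)]
  | atom q ts =>
    simp only [RuleAtom.Eval, realize_congr I (ts _) fun x hx => h x ⟨_, hx⟩]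

/-- The body of a rule, its positive part evaluated "here" and the rest "there". -/
def Rule.BodyEval (I : L.Structure U) (τ σ : SymVal L U) (e : ℕ → U) (r : Rule L) : Prop :=
  (∀ a ∈ r.pos, a.Eval I τ e) ∧ (∀ a ∈ r.neg, ¬ a.Eval I σ e) ∧ ∀ a ∈ r.dneg, a.Eval I σ e

def Rule.HeadEval (I : L.Structure U) (τ : SymVal L U) (e : ℕ → U) (r : Rule L) : Prop :=
  ∃ a ∈ r.head, a.Eval I τ e

theorem Rule.bodyEval_of_body_eq_nil (I : L.Structure U) (τ σ : SymVal L U) (e : ℕ → U)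
    {r : Rule L} (h : r.body = []) : r.BodyEval I τ σ e := by
  simp only [Rule.body, List.append_eq_nil_iff, List.map_eq_nil_iff] at h
  simp [Rule.BodyEval, h]

theorem Rule.holds_body (I : L.Structure U) (σ : SymVal L U) (e : ℕ → U) (r : Rule L) :
    Holds I σ e (.conj r.body) ↔ r.BodyEval I σ σ e := by
  simp only [holds_conj, Rule.body, List.mem_append, or_imp, forall_and, List.forall_mem_map,
    FOFormula.neg, Holds, RuleAtom.holds_toFormula, Rule.BodyEval, and_assoc, imp_false, not_not]

theorem Rule.here_body (I : L.Structure U) {τ σ : SymVal L U} (hle : ∀ q a, τ q a → σ q a)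
    (e : ℕ → U) (r : Rule L) :
    Here I τ σ e (.conj r.body) ↔ r.BodyEval I τ σ e := by
  have key : ∀ a : RuleAtom L, a.Eval I τ e → a.Eval I σ e := fun a h => h.mono hle
  simp only [here_conj, Rule.body, List.mem_append, or_imp, forall_and, List.forall_mem_map,
    FOFormula.neg, Here, Holds, RuleAtom.holds_toFormula, RuleAtom.here_toFormula,
    Rule.BodyEval, and_assoc, imp_false, not_not]
  grind

theorem Rule.holds_matrix (I : L.Structure U) (σ : SymVal L U) (e : ℕ → U) (r : Rule L) :
    Holds I σ e r.matrix ↔ (r.BodyEval I σ σ e → r.HeadEval I σ e) := by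
  have hd : Holds I σ e (.disj (r.head.map RuleAtom.toFormula)) ↔ r.HeadEval I σ e := by
    simp [holds_disj, Rule.HeadEval, RuleAtom.holds_toFormula]
  by_cases h : r.body = []
  · simp [Rule.matrix, h, hd, Rule.bodyEval_of_body_eq_nil]
  · simp [Rule.matrix, h, hd, Holds, Rule.holds_body]

theorem Rule.here_matrix (I : L.Structure U) {τ σ : SymVal L U} (hle : ∀ q a, τ q a → σ q a)
    (e : ℕ → U) (r : Rule L) :
    Here I τ σ e r.matrix ↔ (r.BodyEval I τ σ e → r.HeadEval I τ e) ∧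
      (r.BodyEval I σ σ e → r.HeadEval I σ e) := by
  have hd : Here I τ σ e (.disj (r.head.map RuleAtom.toFormula)) ↔ r.HeadEval I τ e := by
    simp [here_disj, Rule.HeadEval, RuleAtom.here_toFormula]
  have hd' : Holds I σ e (.disj (r.head.map RuleAtom.toFormula)) ↔ r.HeadEval I σ e := by
    simp [holds_disj, Rule.HeadEval, RuleAtom.holds_toFormula]
  by_cases h : r.body = []
  · simp only [Rule.matrix, h, hd, Rule.bodyEval_of_body_eq_nil, if_true, true_imp_iff]
    exact ⟨fun ⟨a, ha, hv⟩ => ⟨⟨a, ha, hv⟩, a, ha, hv.mono hle⟩, fun H => H.1⟩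
  · simp only [Rule.matrix, h, hd, hd', Here, Rule.holds_body, Rule.here_body I hle, if_false]

theorem Rule.holds_toFormula (I : L.Structure U) (σ : SymVal L U) (e : ℕ → U) (r : Rule L) :
    Holds I σ e r.toFormula ↔ ∀ e' : ℕ → U, (∀ y ∉ r.vars, e' y = e y) →
      r.BodyEval I σ σ e' → r.HeadEval I σ e' := by
  simp only [Rule.toFormula, holds_alls, Rule.holds_matrix]

theorem Rule.here_toFormula (I : L.Structure U) {τ σ : SymVal L U}
    (hle : ∀ q a, τ q a → σ q a) (e : ℕ → U) (r : Rule L) :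
    Here I τ σ e r.toFormula ↔ (∀ e' : ℕ → U, (∀ y ∉ r.vars, e' y = e y) →
      (r.BodyEval I τ σ e' → r.HeadEval I τ e') ∧
        (r.BodyEval I σ σ e' → r.HeadEval I σ e')) := by
  simp only [Rule.toFormula, here_alls, Rule.here_matrix I hle]

theorem Rule.here_toFormula_congr (I : L.Structure U) {τ σ : SymVal L U}
    (hle : ∀ q a, τ q a → σ q a) {e f : ℕ → U} {r : Rule L}
    (h : Here I τ σ e r.toFormula) : Here I τ σ f r.toFormula := by
  rw [Rule.here_toFormula I hle] at h ⊢
  intro f' _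
  let e' : ℕ → U := fun x => if x ∈ r.vars then f' x else e x
  have hv : ∀ ρ : SymVal L U, ∀ a ∈ r.head ++ r.pos ++ r.neg ++ r.dneg,
      (a.Eval I ρ e' ↔ a.Eval I ρ f') := fun ρ a ha =>
    a.eval_congr I ρ fun x hx => by simp [e', (r.mem_vars x).2 ⟨a, ha, hx⟩]
  have hb : ∀ ρ ρ' : SymVal L U, r.BodyEval I ρ ρ' e' ↔ r.BodyEval I ρ ρ' f' := fun ρ ρ' =>
    and_congr (forall₂_congr fun a ha => hv ρ a (by simp [ha]))
      (and_congr (forall₂_congr fun a ha => not_congr (hv ρ' a (by simp [ha])))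
        (forall₂_congr fun a ha => hv ρ' a (by simp [ha])))
  have hd : ∀ ρ : SymVal L U, r.HeadEval I ρ e' ↔ r.HeadEval I ρ f' := fun ρ =>
    exists_congr fun a => and_congr_right fun ha => hv ρ a (by simp [ha])
  have := h e' fun y hy => by simp [e', hy]
  rwa [hb, hb, hd, hd] at this

theorem here_self (I : L.Structure U) (σ : SymVal L U) (e : ℕ → U) (F : FOFormula L) :
    Here I σ σ e F ↔ Holds I σ e F := by
  induction F generalizing e <;> simp_all [Here, Holds]

theorem IsRuleConj.here_of_forall {I : L.Structure U} {τ σ : SymVal L U} {e : ℕ → U}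
    {F : FOFormula L} (hF : IsRuleConj F)
    (h : ∀ r : Rule L, r.OccursIn F → Here I τ σ e r.toFormula) : Here I τ σ e F := by
  induction hF with
  | top => simp [FOFormula.top, Here]
  | rule r => exact h r .self
  | and _ _ ihF ihG => exact ⟨ihF fun r hr => h r hr.left, ihG fun r hr => h r hr.right⟩

theorem Rule.OccursIn.here {I : L.Structure U} {τ σ : SymVal L U} {e : ℕ → U}
    {F : FOFormula L} {r : Rule L} (hr : r.OccursIn F) (h : Here I τ σ e F) :
    Here I τ σ e r.toFormula := by
  induction hr with
  | self => exact h
  | left _ ih => exact ih h.1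
  | right _ ih => exact ih h.2

theorem IsRuleConj.here_congr {I : L.Structure U} {τ σ : SymVal L U}
    (hle : ∀ q a, τ q a → σ q a) {e f : ℕ → U} {F : FOFormula L} (hF : IsRuleConj F)
    (h : Here I τ σ e F) : Here I τ σ f F :=
  hF.here_of_forall fun _ hr => Rule.here_toFormula_congr I hle (hr.here h)

/-- Stability with respect to a conjunction of rules does not depend on the values of the
individual variables. -/
theorem Stable.change_env {I : L.Structure U} {σ : SymVal L U} {e f : ℕ → U}
    {p : Finset (Pred L)} {l : List (FOFormula L)} (hl : ∀ F ∈ l, IsRuleConj F)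
    (h : Stable I e p (.conj l) σ) : Stable I f p (.conj l) σ := by
  have key : ∀ (τ : SymVal L U) (e f : ℕ → U), (∀ q a, τ q a → σ q a) →
      Here I τ σ e (.conj l) → Here I τ σ f (.conj l) := by
    intro τ e f hle H
    rw [here_conj] at H ⊢
    exact fun F hF => (hl F hF).here_congr hle (H F hF)
  refine ⟨?_, fun τ hτ hle hH => h.2 τ hτ hle (key τ f e hle hH)⟩
  rw [← here_self]
  exact key σ e f (fun _ _ h => h) ((here_self I σ e _).2 h.1)

end RuleSemantics

section Splitting

variable {L : FirstOrder.Language.{u, v}} {U : Type w}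

/-- A rule is satisfied "here" by `τ'` if it is satisfied "here" by a smaller `τ` and, whenever
some head predicate differs between `τ'` and `σ`, its positive body has the same value in `τ` as
in `τ'`. -/
theorem Rule.here_toFormula_of_le {I : L.Structure U} {τ τ' σ : SymVal L U}
    (hττ' : ∀ q a, τ q a → τ' q a) (hτ'σ : ∀ q a, τ' q a → σ q a) {e : ℕ → U} {r : Rule L}
    (hr : Here I τ σ e r.toFormula)
    (h : ∀ q, PredIn q r.head → τ' q ≠ σ q → ∀ q', PredIn q' r.pos → τ' q' = τ q') :
    Here I τ' σ e r.toFormula := by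
  have hτσ : ∀ q a, τ q a → σ q a := fun q a ha => hτ'σ q a (hττ' q a ha)
  rw [Rule.here_toFormula I hτσ] at hr
  rw [Rule.here_toFormula I hτ'σ]
  refine fun e' he' => ⟨fun hb => ?_, (hr e' he').2⟩
  by_cases hq : ∃ q, PredIn q r.head ∧ τ' q ≠ σ q
  · obtain ⟨q, hq, hne⟩ := hq
    have hpos : ∀ a ∈ r.pos, a.Eval I τ e' := fun a ha => by
      have hv := hb.1 a ha
      cases a with
      | equal s t => exact hv
      | atom q' ts =>
        simp only [RuleAtom.Eval] at hv ⊢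
        rwa [h q hq hne q' ⟨ts, ha⟩] at hv
    obtain ⟨a, ha, hv⟩ := (hr e' he').1 ⟨hpos, hb.2⟩
    exact ⟨a, ha, hv.mono hττ'⟩
  · push Not at hq
    obtain ⟨a, ha, hv⟩ := (hr e' he').2 ⟨fun a ha => (hb.1 a ha).mono hτ'σ, hb.2⟩
    refine ⟨a, ha, ?_⟩
    cases a with
    | equal s t => exact hv
    | atom q ts =>
      simp only [RuleAtom.Eval] at hv ⊢
      rwa [hq q ⟨ts, ha⟩]

/-- A nonempty finite set contains an element that is reachable from all elements of the set
which are reachable from it. -/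
theorem exists_reachable_minimal {α : Type*} (R : α → α → Prop) (Y : Finset α)
    (hY : Y.Nonempty) : ∃ q ∈ Y, ∀ q' ∈ Y, Relation.ReflTransGen R q q' →
      Relation.ReflTransGen R q' q := by
  induction hY using Finset.Nonempty.cons_induction with
  | singleton a => exact ⟨a, by simp, fun q' hq' _ => by simp_all [Relation.ReflTransGen.refl]⟩
  | cons a s has _ ih =>
    obtain ⟨q, hq, hmin⟩ := ih
    by_cases hqa : Relation.ReflTransGen R q a
    · by_cases haq : Relation.ReflTransGen R a q
      · refine ⟨q, by simp [hq], fun q' hq' hr => ?_⟩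
        rcases Finset.mem_cons.1 hq' with rfl | hq'
        · exact haq
        · exact hmin q' hq' hr
      · refine ⟨a, by simp, fun q' hq' hr => ?_⟩
        rcases Finset.mem_cons.1 hq' with rfl | hq'
        · exact .refl
        · exact absurd (hr.trans (hmin q' hq' (hqa.trans hr))) haq
    · refine ⟨q, by simp [hq], fun q' hq' hr => ?_⟩
      rcases Finset.mem_cons.1 hq' with rfl | hq'
      · exact absurd hr hqa
      · exact hmin q' hq' hr

theorem Module.mem_int {P : Module L} {q : Pred L} : q ∈ P.int ↔ ∃ M ∈ P.defmods, q ∈ M.1 := by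
  simp [Module.int]

theorem Module.IsCoherent.stable_of_stable_flatConj {P : Module L} (hP : P.IsCoherent)
    {I : L.Structure U} {σ : SymVal L U} {e : ℕ → U} (hs : Stable I e P.int P.flatConj σ)
    {M : Finset (Pred L) × FOFormula L} (hM : M ∈ P.defmods) : Stable I e M.1 M.2 σ := by
  have hhold : ∀ M ∈ P.defmods, Holds I σ e M.2 := by
    have := hs.1
    rwa [Module.flatConj, holds_conj, List.forall_mem_map] at this
  refine ⟨hhold M hM, fun τ hτ hle hH => hs.2 τ (fun q hq => hτ q fun hqM => hq ?_) hle ?_⟩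
  · exact Module.mem_int.2 ⟨M, hM, hqM⟩
  · rw [Module.flatConj, here_conj, List.forall_mem_map]
    intro M' hM'
    by_cases hne : M = M'
    · rwa [← hne]
    · refine (hP.simple M' hM').1.here_of_forall fun r hr => ?_
      have hrσ : Holds I σ e r.toFormula := by
        rw [← here_self]
        exact hr.here ((here_self I σ e _).2 (hhold M' hM'))
      rw [Rule.holds_toFormula] at hrσ
      rw [Rule.here_toFormula I hle]
      refine fun e' he' => ⟨fun hb => ?_, hrσ e' he'⟩
      obtain ⟨a, ha, hv⟩ := hrσ e' he' ⟨fun a ha => (hb.1 a ha).mono hle, hb.2⟩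
      refine ⟨a, ha, ?_⟩
      cases a with
      | equal s t => exact hv
      | atom q ts =>
        have hq : q ∉ M.1 := fun hq => Finset.disjoint_left.1 (hP.disjoint M hM M' hM' hne) hq
          ((hP.simple M' hM').2 r hr q ⟨ts, ha⟩)
        simp only [RuleAtom.Eval] at hv ⊢
        rwa [hτ q hq]

theorem Module.IsCoherent.stable_flatConj_of_forall_stable {P : Module L} (hP : P.IsCoherent)
    {I : L.Structure U} {σ : SymVal L U} {e : ℕ → U}
    (hs : ∀ M ∈ P.defmods, Stable I e M.1 M.2 σ) : Stable I e P.int P.flatConj σ := by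
  refine ⟨?_, fun τ hτ hle hH => ?_⟩
  · rw [Module.flatConj, holds_conj, List.forall_mem_map]
    exact fun M hM => (hs M hM).1
  rw [Module.flatConj, here_conj, List.forall_mem_map] at hH
  by_contra hne
  have hY : (P.int.filter fun q => τ q ≠ σ q).Nonempty := by
    obtain ⟨q, hq⟩ := Function.ne_iff.1 hne
    exact ⟨q, Finset.mem_filter.2 ⟨by_contra fun h => hq (hτ q h), hq⟩⟩
  obtain ⟨q₀, hq₀, hmin⟩ := exists_reachable_minimal P.DepEdge _ hY
  rw [Finset.mem_filter] at hq₀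
  obtain ⟨M, hM, hCM⟩ := hP.scc _ ⟨q₀, hq₀.1, rfl⟩
  set C : Set (Pred L) := {q | q ∈ P.int ∧ Relation.ReflTransGen P.DepEdge q₀ q ∧
    Relation.ReflTransGen P.DepEdge q q₀} with hC
  let τ' : SymVal L U := fun q => if q ∈ C then τ q else σ q
  have hττ' : ∀ q a, τ q a → τ' q a := by
    intro q a ha
    by_cases hq : q ∈ C
    · simpa [τ', hq] using ha
    · simpa [τ', hq] using hle q a ha
  have hτ'σ : ∀ q a, τ' q a → σ q a := by
    intro q a ha
    by_cases hq : q ∈ C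
    · exact hle q a (by simpa [τ', hq] using ha)
    · simpa [τ', hq] using ha
  have hq₀C : q₀ ∈ C := ⟨hq₀.1, .refl, .refl⟩
  have hτ' : τ' = σ := by
    refine (hs M hM).2 τ' (fun q hq => ?_) hτ'σ ?_
    · have : q ∉ C := fun h => hq (hCM q h)
      simp [τ', this]
    · refine (hP.simple M hM).1.here_of_forall fun r hr =>
        Rule.here_toFormula_of_le hττ' hτ'σ (hr.here (hH M hM)) fun q hq hqne q' hq' => ?_
      have hqC : q ∈ C := by
        by_contra h
        simp [τ', h] at hqne
      by_cases hq'C : q' ∈ C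
      · simp [τ', hq'C]
      · have : τ q' = σ q' := by
          by_contra hne'
          have hint : q' ∈ P.int := by_contra fun h => hne' (hτ q' h)
          have hreach : Relation.ReflTransGen P.DepEdge q₀ q' :=
            hqC.2.1.tail ⟨hqC.1, hint, M, hM, r, hr, hq, hq'⟩
          exact hq'C ⟨hint, hreach, hmin q' (Finset.mem_filter.2 ⟨hint, hne'⟩) hreach⟩
        simp [τ', hq'C, this]
  apply hq₀.2
  have := congrFun hτ' q₀
  simpa [τ', hq₀C] using this

end Splitting

section Prenex

variable {L : FirstOrder.Language.{u, v}} {U : Type w}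

namespace SOFormula

theorem free_subset_occ (φ : SOFormula L) : φ.free ⊆ φ.occ := by
  induction φ with
  | atom n ts => cases n <;> simp [free, occ]
  | and φ ψ ih ih' | or φ ψ ih ih' | imp φ ψ ih ih' => exact Finset.union_subset_union ih ih'
  | exPred H φ ih => exact (Finset.filter_subset _ _).trans ih
  | _ => simp_all [free, occ]

theorem allFree_of_notMem_occ {q : Pred L} {φ : SOFormula L} (h : q ∉ φ.occ) :
    AllFree q φ := by
  induction φ <;> simp_all [AllFree, occ]

theorem mem_free_of_allFree {q : Pred L} {φ : SOFormula L} (h : AllFree q φ)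
    (hq : q ∈ φ.occ) : q ∈ φ.free := by
  induction φ with
  | atom n ts => cases n <;> simp_all [free, occ]
  | exPred H φ ih =>
    simp only [AllFree] at h
    simp only [occ] at hq
    simp only [free, Finset.mem_filter]
    exact ⟨ih h.1 hq, fun hH => h.2 hH hq⟩
  | and φ ψ ih ih' | or φ ψ ih ih' | imp φ ψ ih ih' =>
    simp only [free, occ, AllFree, Finset.mem_union] at *
    exact hq.imp (ih h.1) (ih' h.2)
  | all x φ ih | ex x φ ih => exact ih h hq
  | _ => simp [occ] at hq

theorem sat_conj_cons (I : L.Structure U) (ρ : PVal L U) (e : ℕ → U) (φ : SOFormula L)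
    (l : List (SOFormula L)) :
    Sat I ρ e (conj (φ :: l)) ↔ Sat I ρ e φ ∧ Sat I ρ e (conj l) := by
  simp [sat_conj]

theorem occ_conj_cons (φ : SOFormula L) (l : List (SOFormula L)) :
    (conj (φ :: l)).occ = φ.occ ∪ (conj l).occ := by
  cases l <;> simp [conj, occ, top]

theorem allFree_conj_cons (q : Pred L) (φ : SOFormula L) (l : List (SOFormula L)) :
    AllFree q (conj (φ :: l)) ↔ AllFree q φ ∧ AllFree q (conj l) := by
  cases l <;> simp [conj, AllFree, top]

theorem oneBinder_conj_cons (q : Pred L) (φ : SOFormula L) (l : List (SOFormula L)) :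
    OneBinder q (conj (φ :: l)) ↔
      (OneBinder q φ ∧ q ∉ (conj l).occ) ∨ (q ∉ φ.occ ∧ OneBinder q (conj l)) := by
  cases l <;> simp [conj, OneBinder, top, occ]

theorem occ_subset_occ_conj {φ : SOFormula L} {l : List (SOFormula L)} (h : φ ∈ l) :
    φ.occ ⊆ (conj l).occ := by
  induction l with
  | nil => simp at h
  | cons ψ l ih =>
    rw [occ_conj_cons]
    rcases List.mem_cons.1 h with rfl | h
    · exact Finset.subset_union_left
    · exact (ih h).trans Finset.subset_union_right

theorem occ_alls (xs : List ℕ) (φ : SOFormula L) : (alls xs φ).occ = φ.occ := by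
  induction xs with
  | nil => rfl
  | cons x xs ih => exact ih

theorem allFree_alls (q : Pred L) (xs : List ℕ) (φ : SOFormula L) :
    AllFree q (alls xs φ) ↔ AllFree q φ := by
  induction xs with
  | nil => rfl
  | cons x xs ih => exact ih

theorem allFree_conj (q : Pred L) (l : List (SOFormula L)) :
    AllFree q (conj l) ↔ ∀ φ ∈ l, AllFree q φ := by
  induction l with
  | nil => simp [conj, top, AllFree]
  | cons φ l ih => simp [allFree_conj_cons, ih]

end SOFormula

theorem FOFormula.occ_toSO (F : FOFormula L) : F.toSO.occ = F.pred := by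
  induction F <;> simp_all [FOFormula.toSO, FOFormula.pred, SOFormula.occ]

theorem FOFormula.allFree_toSO (q : Pred L) (F : FOFormula L) : F.toSO.AllFree q := by
  induction F <;> simp_all [FOFormula.toSO, SOFormula.AllFree]

theorem FOFormula.allFree_star (q : Pred L) (p : Finset (Pred L)) (F : FOFormula L) :
    (F.star p).AllFree q := by
  induction F with
  | atom r ts => by_cases h : r ∈ p <;> simp [FOFormula.star, h, SOFormula.AllFree]
  | _ => simp_all [FOFormula.star, SOFormula.AllFree, FOFormula.allFree_toSO]

theorem pred_subset_occ_SM (p : Finset (Pred L)) (F : FOFormula L) : F.pred ⊆ (SM p F).occ := by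
  rw [← F.occ_toSO]
  exact Finset.subset_union_left

theorem subset_occ_SM (p : Finset (Pred L)) (F : FOFormula L) : p ⊆ (SM p F).occ := by
  intro q hq
  have h1 : q ∈ (varLe q).occ := by
    simp [varLe, SOFormula.occ_alls, SOFormula.occ]
  have h2 := SOFormula.occ_subset_occ_conj
    (List.mem_map_of_mem (f := varLe) (Finset.mem_toList.2 hq)) h1
  simp [SM, SOFormula.occ, SOFormula.neg, varsLt, h2]

theorem allFree_SM (q : Pred L) (p : Finset (Pred L)) (F : FOFormula L) :
    (SM p F).AllFree q := by
  have h₁ : ∀ r : Pred L, (varLe r).AllFree q := fun r => by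
    simp [varLe, SOFormula.allFree_alls, SOFormula.AllFree]
  have h₂ : ∀ r : Pred L, (leVar r).AllFree q := fun r => by
    simp [leVar, SOFormula.allFree_alls, SOFormula.AllFree]
  simp only [SM, SOFormula.AllFree, SOFormula.neg, varsLt, varsOf, F.allFree_toSO,
    F.allFree_star, SOFormula.allFree_conj, List.forall_mem_map, h₁, h₂]
  simp

namespace Module

mutual

theorem subset_occ_Phi : (M : Module L) → ∀ d ∈ M.defmods,
    d.1 ⊆ M.Phi.occ ∧ d.2.pred ⊆ M.Phi.occ
  | defm p F => by
    simp only [defmods, List.mem_singleton, forall_eq, Phi]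
    exact ⟨subset_occ_SM p F, pred_subset_occ_SM p F⟩
  | prog S Ms => by
    simp only [defmods, Phi, exSyms, SOFormula.occ]
    exact subset_occ_PhiList Ms

theorem subset_occ_PhiList : (Ms : List (Module L)) → ∀ d ∈ defmodsList Ms,
    d.1 ⊆ (SOFormula.conj (PhiList Ms)).occ ∧ d.2.pred ⊆ (SOFormula.conj (PhiList Ms)).occ
  | [] => by simp [defmodsList]
  | M :: Ms => by
    intro d hd
    rw [PhiList, SOFormula.occ_conj_cons]
    rw [defmodsList, List.mem_append] at hd
    rcases hd with hd | hd
    · exact ⟨(subset_occ_Phi M d hd).1.trans Finset.subset_union_left,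
        (subset_occ_Phi M d hd).2.trans Finset.subset_union_left⟩
    · exact ⟨(subset_occ_PhiList Ms d hd).1.trans Finset.subset_union_right,
        (subset_occ_PhiList Ms d hd).2.trans Finset.subset_union_right⟩

end

mutual

/-- In `α`-normal form, all predicate quantifiers of `Φ(M)` can be moved to the front. -/
theorem sat_Phi_iff (I : L.Structure U) (e : ℕ → U) : (M : Module L) →
    (∀ q, M.Phi.AllFree q ∨ M.Phi.OneBinder q) → ∀ ρ : PVal L U,
    (SOFormula.Sat I ρ e M.Phi ↔ ∃ σ : SymVal L U,
      (∀ q, M.Phi.AllFree q → σ q = ρ.symVal q) ∧ ∀ d ∈ M.defmods, Stable I e d.1 d.2 σ)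
  | defm p F => by
    intro _ ρ
    simp only [defmods, List.mem_singleton, forall_eq, Phi, allFree_SM, true_imp_iff, sat_SM]
    refine ⟨fun h => ⟨_, fun _ => rfl, h⟩, fun ⟨σ, hσ, h⟩ => ?_⟩
    rwa [← funext hσ]
  | prog S Ms => by
    intro hα ρ
    simp only [Phi, exSyms, SOFormula.Sat, defmods]
    simp only [Phi, exSyms] at hα
    set φ := SOFormula.conj (PhiList Ms) with hφ
    set H := φ.free.filter (fun q => q ∉ S) with hH
    have ih := sat_PhiList_iff I e Ms (fun q => by
      rcases hα q with h | h
      · exact Or.inl h.1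
      · rcases h with h | h
        · exact Or.inl h.2
        · exact Or.inr h)
    rw [← hφ] at ih
    constructor
    · rintro ⟨ρ', hρ', hsat⟩
      obtain ⟨σ, hσ, hst⟩ := (ih ρ').1 hsat
      refine ⟨σ, fun q hq => ?_, hst⟩
      rw [hσ q hq.1]
      refine hρ' _ fun hqH => ?_
      have hqH' : q ∈ H := by simpa using hqH
      exact hq.2 hqH (φ.free_subset_occ (Finset.mem_filter.1 hqH').1)
    · rintro ⟨σ, hσ, hst⟩
      refine ⟨.ofVals (fun q => if q ∈ H then σ q else ρ.symVal q) ρ.varVal, ?_, (ih _).2 ⟨σ, fun q hq => ?_, hst⟩⟩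
      · rintro (q | q) hn
        · have : q ∉ H := fun h => hn (Finset.mem_image_of_mem _ h)
          simp only [PVal.ofVals, this, if_false]
          rfl
        · rfl
      · by_cases hqH : q ∈ H
        · simp [hqH]
        · simp only [PVal.symVal_ofVals, hqH, if_false]
          exact hσ q ⟨hq, fun h => absurd (by simpa using h) hqH⟩

theorem sat_PhiList_iff (I : L.Structure U) (e : ℕ → U) : (Ms : List (Module L)) →
    (∀ q, (SOFormula.conj (PhiList Ms)).AllFree q ∨ (SOFormula.conj (PhiList Ms)).OneBinder q) →
    ∀ ρ : PVal L U,
    (SOFormula.Sat I ρ e (SOFormula.conj (PhiList Ms)) ↔ ∃ σ : SymVal L U,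
      (∀ q, (SOFormula.conj (PhiList Ms)).AllFree q → σ q = ρ.symVal q) ∧
        ∀ d ∈ defmodsList Ms, Stable I e d.1 d.2 σ)
  | [] => by
    intro _ ρ
    simp only [PhiList, SOFormula.conj, SOFormula.top, SOFormula.Sat, defmodsList]
    exact ⟨fun _ => ⟨ρ.symVal, fun _ _ => rfl, by simp⟩, fun _ h => h⟩
  | M :: Ms => by
    intro hα ρ
    simp only [PhiList, SOFormula.allFree_conj_cons, SOFormula.oneBinder_conj_cons] at hα
    simp only [PhiList, SOFormula.allFree_conj_cons, SOFormula.sat_conj_cons, defmodsList,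
      List.mem_append, or_imp, forall_and]
    have ih := sat_Phi_iff I e M (fun q => by
      rcases hα q with h | h | h
      · exact .inl h.1
      · exact .inr h.1
      · exact .inl (SOFormula.allFree_of_notMem_occ h.1)) ρ
    have ih' := sat_PhiList_iff I e Ms (fun q => by
      rcases hα q with h | h | h
      · exact .inl h.2
      · exact .inl (SOFormula.allFree_of_notMem_occ h.2)
      · exact .inr h.2) ρ
    have hocc := subset_occ_Phi M
    have hocc' := subset_occ_PhiList Ms
    set φ := M.Phi
    set ψ := SOFormula.conj (PhiList Ms)
    have hφ : ∀ q ∈ φ.occ, ψ.AllFree q := fun q hq => by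
      rcases hα q with h | h | h
      · exact h.2
      · exact SOFormula.allFree_of_notMem_occ h.2
      · exact absurd hq h.1
    have hψ : ∀ q ∈ ψ.occ, φ.AllFree q := fun q hq => by
      rcases hα q with h | h | h
      · exact h.1
      · exact absurd hq h.2
      · exact SOFormula.allFree_of_notMem_occ h.1
    rw [ih, ih']
    constructor
    · rintro ⟨⟨σ₁, hσ₁, hs₁⟩, σ₂, hσ₂, hs₂⟩
      have h₁ : ∀ q ∈ φ.occ, σ₁ q = if φ.AllFree q then σ₂ q else σ₁ q := fun q hq => by
        split_ifs with h
        · rw [hσ₁ q h, hσ₂ q (hφ q hq)]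
        · rfl
      have h₂ : ∀ q ∈ ψ.occ, σ₂ q = if φ.AllFree q then σ₂ q else σ₁ q := fun q hq => by
        simp [hψ q hq]
      refine ⟨fun q => if φ.AllFree q then σ₂ q else σ₁ q, fun q hq => ?_,
        fun d hd => ?_, fun d hd => ?_⟩
      · simp [hq.1, hσ₂ q hq.2]
      · exact (hs₁ d hd).congr (fun q hq => h₁ q ((hocc d hd).1 hq))
          (fun q hq => h₁ q ((hocc d hd).2 hq))
      · exact (hs₂ d hd).congr (fun q hq => h₂ q ((hocc' d hd).1 hq))
          (fun q hq => h₂ q ((hocc' d hd).2 hq))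
    · rintro ⟨σ, hσ, hs, hs'⟩
      have h₁ : ∀ q ∈ φ.occ, σ q = if φ.AllFree q then ρ.symVal q else σ q := fun q hq => by
        split_ifs with h
        · exact hσ q ⟨h, hφ q hq⟩
        · rfl
      have h₂ : ∀ q ∈ ψ.occ, σ q = if ψ.AllFree q then ρ.symVal q else σ q := fun q hq => by
        split_ifs with h
        · exact hσ q ⟨hψ q hq, h⟩
        · rfl
      refine ⟨⟨fun q => if φ.AllFree q then ρ.symVal q else σ q, fun q hq => by simp [hq],
        fun d hd => ?_⟩, fun q => if ψ.AllFree q then ρ.symVal q else σ q,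
        fun q hq => by simp [hq], fun d hd => ?_⟩
      · exact (hs d hd).congr (fun q hq => h₁ q ((hocc d hd).1 hq))
          (fun q hq => h₁ q ((hocc d hd).2 hq))
      · exact (hs' d hd).congr (fun q hq => h₂ q ((hocc' d hd).1 hq))
          (fun q hq => h₂ q ((hocc' d hd).2 hq))

end

end Module

end Prenex

section Flattening

variable {L : FirstOrder.Language.{u, v}} {U : Type w}

theorem FOFormula.exists_mem_pred_of_mem_pred_conj {q : Pred L} {l : List (FOFormula L)}
    (h : q ∈ (FOFormula.conj l).pred) : ∃ F ∈ l, q ∈ F.pred := by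
  induction l using FOFormula.conj.induct with
  | case1 => simp [FOFormula.conj, FOFormula.top, FOFormula.pred] at h
  | case2 F => exact ⟨F, by simp, h⟩
  | case3 F G l ih =>
    simp only [FOFormula.conj, FOFormula.pred, Finset.mem_union] at h
    rcases h with h | h
    · exact ⟨F, by simp, h⟩
    · obtain ⟨F', hF', hq⟩ := ih h
      exact ⟨F', List.mem_cons_of_mem _ hF', hq⟩

theorem Module.int_subset_occ_Phi (P : Module L) : P.int ⊆ P.Phi.occ := fun q hq => by
  obtain ⟨M, hM, hqM⟩ := Module.mem_int.1 hq
  exact (P.subset_occ_Phi M hM).1 hqM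

theorem Module.pred_flatConj_subset_occ_Phi (P : Module L) :
    P.flatConj.pred ⊆ P.Phi.occ := fun q hq => by
  obtain ⟨F, hF, hqF⟩ := FOFormula.exists_mem_pred_of_mem_pred_conj hq
  obtain ⟨M, hM, rfl⟩ := List.mem_map.1 hF
  exact (P.subset_occ_Phi M hM).2 hqF

theorem sat_exSyms_SM (I : L.Structure U) (ρ : PVal L U) (e : ℕ → U) (h p : Finset (Pred L))
    (F : FOFormula L) : SOFormula.Sat I ρ e (exSyms h (SM p F)) ↔
      ∃ σ : SymVal L U, (∀ q ∉ h, σ q = ρ.symVal q) ∧ Stable I e p F σ := by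
  simp only [exSyms, SOFormula.Sat, sat_SM]
  constructor
  · rintro ⟨ρ', hρ', hs⟩
    exact ⟨_, fun q hq => hρ' _ (by simpa using hq), hs⟩
  · rintro ⟨σ, hσ, hs⟩
    refine ⟨.ofVals σ ρ.varVal, ?_, hs⟩
    rintro (q | q) hn
    · exact hσ q fun h => hn (Finset.mem_image_of_mem _ h)
    · rfl

theorem Module.notMem_iff_allFree_Phi_prog {S : Set (Pred L)} {Ms : List (Module L)}
    (hpub : ∀ q ∈ S, (prog S Ms).Phi.AllFree q) {h : Finset (Pred L)}
    (hh : ∀ q, q ∈ h ↔ q ∈ (prog S Ms).Phi.occ ∧ q ∉ S) (q : Pred L) :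
    q ∉ h ↔ (prog S Ms).Phi.AllFree q := by
  rw [hh]
  constructor
  · intro hq
    by_cases hqS : q ∈ S
    · exact hpub q hqS
    · exact SOFormula.allFree_of_notMem_occ fun ho => hq ⟨ho, hqS⟩
  · rintro hfree ⟨ho, hqS⟩
    simp only [Module.Phi, exSyms, SOFormula.AllFree, SOFormula.occ] at hfree ho
    refine hfree.2 (Finset.mem_image_of_mem _ (Finset.mem_filter.2 ⟨?_, hqS⟩)) ho
    exact SOFormula.mem_free_of_allFree hfree.1 ho

theorem Module.IsCoherent.sat_Phi_iff_sat_flatConj {S : Set (Pred L)} {Ms : List (Module L)}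
    (hcoh : (prog S Ms).IsCoherent) (hpub : ∀ q ∈ S, (prog S Ms).Phi.AllFree q)
    {h : Finset (Pred L)} (hh : ∀ q, q ∈ h ↔ q ∈ (prog S Ms).Phi.occ ∧ q ∉ S)
    (I : L.Structure U) (ρ : PVal L U) (e : ℕ → U) :
    SOFormula.Sat I ρ e (prog S Ms).Phi ↔
      SOFormula.Sat I ρ e (exSyms h (SM (prog S Ms).int (prog S Ms).flatConj)) := by
  rw [Module.sat_Phi_iff I e _ hcoh.alphaNF, sat_exSyms_SM]
  simp only [Module.notMem_iff_allFree_Phi_prog hpub hh]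
  exact exists_congr fun σ => and_congr_right fun _ =>
    ⟨hcoh.stable_flatConj_of_forall_stable, fun hs _ hM => hcoh.stable_of_stable_flatConj hs hM⟩

end Flattening

section AnswerSets

variable {L : FirstOrder.Language.{u, v}}

/-- The predicates of a Herbrand interpretation. -/
def atomVal (A : Set (GroundAtom L)) : SymVal L (GroundTerm L) := fun q ts => ⟨q, ts⟩ ∈ A

theorem isAnswerSetFor_iff (p : Finset (Pred L)) (F : FOFormula L) (A : Set (GroundAtom L)) :
    IsAnswerSetFor p F A ↔ ∀ e, Stable (herbrand A) e p F (atomVal A) := by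
  simp only [IsAnswerSetFor, SOFormula.IsModel, sat_SM]
  constructor
  · intro H e
    exact H (.ofVals (atomVal A) (atomVal A)) (fun _ _ => Iff.rfl) e
  · intro H ρ hρ e
    rw [show ρ.symVal = atomVal A from funext fun q => funext fun a => propext (hρ q a)]
    exact H e

theorem realize_herbrand (A B : Set (GroundAtom L)) (e : ℕ → GroundTerm L) (t : L.Term ℕ) :
    @Language.Term.realize L _ (herbrand A) _ e t =
      @Language.Term.realize L _ (herbrand B) _ e t := by
  induction t with
  | var x => rfl
  | func f ts ih =>
    simp only [Language.Term.realize]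
    exact congrArg (Language.Term.func f) (funext ih)

theorem holds_herbrand (A B : Set (GroundAtom L)) (σ : SymVal L (GroundTerm L))
    (e : ℕ → GroundTerm L) (F : FOFormula L) :
    Holds (herbrand A) σ e F ↔ Holds (herbrand B) σ e F := by
  induction F generalizing e <;> simp_all [Holds, realize_herbrand A B]

theorem here_herbrand (A B : Set (GroundAtom L)) (τ σ : SymVal L (GroundTerm L))
    (e : ℕ → GroundTerm L) (F : FOFormula L) :
    Here (herbrand A) τ σ e F ↔ Here (herbrand B) τ σ e F := by
  induction F generalizing e <;>
    simp_all [Here, realize_herbrand A B, holds_herbrand A B]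

theorem stable_herbrand (A B : Set (GroundAtom L)) (σ : SymVal L (GroundTerm L))
    (e : ℕ → GroundTerm L) (p : Finset (Pred L)) (F : FOFormula L) :
    Stable (herbrand A) e p F σ ↔ Stable (herbrand B) e p F σ := by
  simp only [Stable, holds_herbrand A B, here_herbrand A B]

theorem Module.IsCoherent.isProgAnswerSet_iff {S : Set (Pred L)} {Ms : List (Module L)}
    (hcoh : (Module.prog S Ms).IsCoherent)
    (hpub : ∀ q ∈ S, (Module.prog S Ms).Phi.AllFree q)
    {h : Finset (Pred L)} (hh : ∀ q, q ∈ h ↔ q ∈ (Module.prog S Ms).Phi.occ ∧ q ∉ S)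
    [Nonempty (GroundTerm L)] (A : Set (GroundAtom L)) :
    IsProgAnswerSet S Ms A ↔ ∃ J : Set (GroundAtom L),
      IsAnswerSetFor (Module.prog S Ms).int (Module.prog S Ms).flatConj J ∧
        A = restrict J S := by
  simp only [IsProgAnswerSet, Module.IsModelOf, SOFormula.IsModel,
    hcoh.sat_Phi_iff_sat_flatConj hpub hh, sat_exSyms_SM, isAnswerSetFor_iff]
  have hrules : ∀ F ∈ (Module.prog S Ms).defmods.map Prod.snd, IsRuleConj F := by
    rw [List.forall_mem_map]
    exact fun M hM => (hcoh.simple M hM).1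
  constructor
  · rintro ⟨hAS, H⟩
    obtain ⟨t⟩ := ‹Nonempty (GroundTerm L)›
    obtain ⟨σ, hσ, hs⟩ := H (.ofVals (atomVal A) (atomVal A)) (fun _ _ => Iff.rfl) (fun _ => t)
    refine ⟨{a | σ a.1 a.2}, fun e => ?_, ?_⟩
    · exact (stable_herbrand A _ _ _ _ _).1 (hs.change_env hrules)
    · have hS : ∀ a : GroundAtom L, a.1 ∈ S → (σ a.1 a.2 ↔ a ∈ A) := fun a ha => by
        rw [hσ a.1 fun hm => ((hh a.1).1 hm).2 ha]
        rfl
      ext a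
      exact ⟨fun ha => ⟨(hS a (hAS a ha)).2 ha, hAS a ha⟩, fun ha => (hS a ha.2).1 ha.1⟩
  · rintro ⟨J, hJ, rfl⟩
    refine ⟨fun a ha => ha.2, fun ρ hρ e => ?_⟩
    have hρ' : ∀ q, ρ.symVal q = atomVal (restrict J S) q := fun q =>
      funext fun a => propext (hρ q a)
    have key : ∀ q ∈ (Module.prog S Ms).Phi.occ,
        atomVal J q = if q ∈ h then atomVal J q else ρ.symVal q := fun q hq => by
      split_ifs with hqh
      · rfl
      · have hqS : q ∈ S := by_contra fun hqS => hqh ((hh q).2 ⟨hq, hqS⟩)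
        rw [hρ' q]
        funext a
        exact propext ⟨fun ha => ⟨ha, hqS⟩, fun ha => ha.1⟩
    refine ⟨fun q => if q ∈ h then atomVal J q else ρ.symVal q, fun q hq => by simp [hq], ?_⟩
    exact ((stable_herbrand J _ _ _ _ _).1 (hJ e)).congr
      (fun q hq => key q (Module.int_subset_occ_Phi _ hq))
      (fun q hq => key q (Module.pred_flatConj_subset_occ_Phi _ hq))

end AnswerSets

end ASP

theorem theorem1 {L : FirstOrder.Language.{u, v}} (S : Set (ASP.Pred L))
    (Ms : List (ASP.Module L)) (P : ASP.Module L) (hP : P = ASP.Module.prog S Ms)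
    (hcoh : P.IsCoherent) (hpub : ∀ q ∈ S, P.Phi.AllFree q)
    (h : Finset (ASP.Pred L)) (hh : ∀ q, q ∈ h ↔ q ∈ P.Phi.occ ∧ q ∉ S) :
    (∀ (U : Type w) [Nonempty U] (I : L.Structure U),
      P.IsModelOf I ↔ (ASP.exSyms h (ASP.SM P.int P.flatConj)).IsModel I) ∧
    (Nonempty (ASP.GroundTerm L) → ∀ I : Set (ASP.GroundAtom L),
      ASP.IsProgAnswerSet S Ms I ↔
        ∃ J : Set (ASP.GroundAtom L),
          ASP.IsAnswerSetFor P.int P.flatConj J ∧ I = ASP.restrict J S) ∧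
    (Nonempty (ASP.GroundTerm L) → P.int = P.flatConj.pred →
      ∀ I : Set (ASP.GroundAtom L),
        ASP.IsProgAnswerSet S Ms I ↔
          ∃ J : Set (ASP.GroundAtom L),
            ASP.IsAnswerSet P.flatConj J ∧ I = ASP.restrict J S) := by
  subst hP
  refine ⟨fun U _ I => ?_, fun hne I => ?_, fun hne hint I => ?_⟩
  · exact forall_congr' fun ρ => forall_congr' fun _ => forall_congr' fun e =>
      hcoh.sat_Phi_iff_sat_flatConj hpub hh I ρ e
  · exact hcoh.isProgAnswerSet_iff hpub hh I
  · simp only [ASP.IsAnswerSet, ← hint]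
    exact hcoh.isProgAnswerSet_iff hpub hh I
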